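/- Let $p$ and $q$ be distinct odd primes with $pq\notin\{15,21,39,55\}$, and suppose that there is an elliptic curve over $\mathbb{Q}$ of conductor $pq$ with a rational point of order $2$. Then, possibly after swapping $p$ and $q$, at least one of the following seven Diophantine equations has a solution in integers $A,a,b$ with $a,b>0$ (in each equation the signs $\pm$ on the two sides may be chosen independently of each other): (1) $1=2^{4}q^{b}-p^{a}$; (2) $|p^{a}-q^{b}|=16$; (3) $A^{2}+64=p^{a}q^{b}$; (4) $A^{2}\pm 64q^{b}=\pm p^{a}$; (5) $A^{2}+4sq^{b}=\pm 256p^{a}$ for some sign $s\in\{1,-1\}$ such that $q^{b}\equiv -s \pmod 8$; (6) $A^{2}\pm 4p^{a}q^{b}=\pm 256$; (7) $A^{2}\pm 64p^{a}q^{b}=\pm 1$. -/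

import Mathlib

open scoped NumberField

noncomputable section

namespace WeierstrassCurve

/-- The `n`-torsion field `ℚ(E[n])`: the field generated over `ℚ` by the coordinates of all points
of `E` over an algebraic closure of `ℚ` that are killed by `n`. -/
def torsionField (W : WeierstrassCurve ℚ) (n : ℕ) : IntermediateField ℚ (AlgebraicClosure ℚ) :=
  open scoped Classical in
  IntermediateField.adjoin ℚ
    {z | ∃ (x y : AlgebraicClosure ℚ)
        (h : (W.baseChange (AlgebraicClosure ℚ)).toAffine.Nonsingular x y),
      n • Affine.Point.some x y h = 0 ∧ (z = x ∨ z = y)}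

/-- The Galois group of `ℚ(E[n])` over `ℚ`. -/
abbrev torsionGal (W : WeierstrassCurve ℚ) (n : ℕ) : Type :=
  W.torsionField n ≃ₐ[ℚ] W.torsionField n

/-- The `i`-th ramification group (lower numbering) of `ℚ(E[n]) / ℚ` at the prime `P`: all `σ` with
`σ x ≡ x` modulo `P ^ (i + 1)` for every algebraic integer `x` of `ℚ(E[n])`. -/
def ramificationGroup (W : WeierstrassCurve ℚ) (n : ℕ) (P : Ideal (𝓞 (W.torsionField n))) (i : ℕ) :
    Subgroup (W.torsionGal n) :=
  (P ^ (i + 1)).inertia (W.torsionGal n)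

/-- For a prime `n = ℓ`, the codimension over `𝔽_ℓ` of the fixed space `E[ℓ]^H` in `E[ℓ]`, where
`H` is a subgroup of the Galois group of `ℚ(E[ℓ])`. The index of `E[ℓ]^H` in `E[ℓ]` is `ℓ` to the
power of this codimension, so that the logarithm is exact. -/
def torsionCodim (W : WeierstrassCurve ℚ) (n : ℕ) (H : Subgroup (W.torsionGal n)) : ℕ :=
  open scoped Classical in
  letI E := (W.baseChange (W.torsionField n)).toAffine.Point
  letI torsion : AddSubgroup E := (nsmulAddMonoidHom n : E →+ E).ker
  letI fixed : AddSubgroup E :=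
    ⨅ σ ∈ H, (Affine.Point.map (W' := W.toAffine)
      (σ : W.torsionField n →ₐ[ℚ] W.torsionField n)).eqLocus (AddMonoidHom.id E)
  Nat.log n (fixed.relIndex torsion)

/-- A prime of `ℚ(E[n])` above `p`; all choices are conjugate under the Galois group. -/
def primeAbove (W : WeierstrassCurve ℚ) (n p : ℕ) [hp : Fact p.Prime] :
    Ideal (𝓞 (W.torsionField n)) :=
  haveI : (Ideal.span {(p : ℤ)}).IsPrime := by
    rw [Ideal.span_singleton_prime (by exact_mod_cast hp.out.ne_zero)]
    exact Nat.prime_iff_prime_int.mp hp.out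
  ((Ideal.nonempty_primesOver (S := 𝓞 (W.torsionField n)) (Ideal.span {(p : ℤ)})).some : _)

/-- The wild part `δ_p = ∑_{i ≥ 1} (|G_i| / |G_0|) dim (E[ℓ] / E[ℓ]^{G_i})` of the conductor
exponent of `E` at `p`. Here `ℓ ≠ p` is an auxiliary prime (`δ_p` does not depend on it), and `G_i`
are the ramification groups of `ℚ(E[ℓ]) / ℚ` at a prime above `p`. The sum is a natural number
(a theorem), so that the floor changes nothing. -/
def wildExponent (W : WeierstrassCurve ℚ) (p : ℕ) [Fact p.Prime] : ℕ :=
  letI l : ℕ := if p = 2 then 3 else 2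
  letI G : ℕ → Subgroup (W.torsionGal l) := W.ramificationGroup l (W.primeAbove l p)
  ⌊∑ᶠ i : ℕ, (Nat.card (G (i + 1)) : ℚ) / Nat.card (G 0) * W.torsionCodim l (G (i + 1))⌋₊

open scoped Classical in
/-- The exponent of the conductor of `E` at `p`: `0` if `E` has good reduction at `p`, `1` if it has
multiplicative reduction at `p`, and `2 + δ_p` if it has additive reduction at `p`. The type of
reduction is read off from a minimal Weierstrass equation of `E` over `ℤ_p`. -/
def conductorExponent (W : WeierstrassCurve ℚ) (p : ℕ) [Fact p.Prime] : ℕ :=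
  letI Wp : WeierstrassCurve ℚ_[p] := (W.baseChange ℚ_[p]).minimal ℤ_[p]
  if Wp.HasGoodReduction ℤ_[p] then 0
  else if Wp.HasMultiplicativeReduction ℤ_[p] then 1
  else 2 + W.wildExponent p

/-- The conductor of an elliptic curve over `ℚ`: the product of `p ^ f_p` over all primes `p`, with
`f_p` the conductor exponent at `p`. Only the finitely many primes of bad reduction contribute. -/
def conductor (W : WeierstrassCurve ℚ) : ℕ :=
  ∏ᶠ p : Nat.Primes, haveI : Fact (p : ℕ).Prime := ⟨p.2⟩; (p : ℕ) ^ W.conductorExponent p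

end WeierstrassCurve

end

/-- One of the seven Diophantine equations, for the ordered pair `(p, q)`, has an integral solution
`(A, a, b)` with `a, b > 0`. The units `s` and `t` of `ℤ` are the signs `±`, and they vary
independently of each other. -/
def HasDiophantineSolution (p q : ℤ) : Prop :=
  ∃ (A : ℤ) (a b : ℕ), 0 < a ∧ 0 < b ∧
    (1 = 2 ^ 4 * q ^ b - p ^ a ∨
      |p ^ a - q ^ b| = 16 ∨
      A ^ 2 + 64 = p ^ a * q ^ b ∨
      (∃ s t : ℤˣ, A ^ 2 + s * (64 * q ^ b) = t * p ^ a) ∨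
      (∃ s t : ℤˣ, A ^ 2 + s * (4 * q ^ b) = t * (256 * p ^ a) ∧ q ^ b ≡ -s [ZMOD 8]) ∨
      (∃ s t : ℤˣ, A ^ 2 + s * (4 * p ^ a * q ^ b) = t * 256) ∨
      (∃ s t : ℤˣ, A ^ 2 + s * (64 * p ^ a * q ^ b) = t))

/-!
Let `W` be an elliptic curve over `ℚ` of conductor `p q` with a rational point of order two. The
conductor is squarefree, so `W` has multiplicative reduction at `p` and `q` and good reduction
elsewhere, in particular at `2`. Moving the point of order two to the origin gives an equation
`Y ^ 2 = X ^ 3 + A X ^ 2 + B X` with `B ^ 2 (A ^ 2 - 4 B) = 256 Δ` and `A ^ 2 - 3 B = c₄`. A change of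
variables multiplies `A` and `B` by `c ^ 2` and `c ^ 4`.

Over `ℤ_[r]`, for each prime `r`, the coefficients `A` and `B` attached to a minimal equation are
integral and not both divisible by `r` (`norm_twoTorsion_eq_one`). For `r ≠ 2` this is read off from
the two identities; for `r = 2` one also needs that a curve with good supersingular reduction has no
point of order two over `ℚ_[2]`. Scaling `A` and `B` over `ℚ` until no prime can be removed
produces one pair of coprime integers that is optimal at all primes at once
(`exists_coprime_model`), so that `B ^ 2 (A ^ 2 - 4 B) = 256 M`, where the prime divisors of `M` are
`p` and `q`.

Replacing the curve by a `2`-isogenous one if `A` is even, one gets `A ^ 2 - 64 u = v` with `A` odd,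
`u` and `v` coprime, and `p`, `q` the prime divisors of `u v` (`exists_sq_sub_eq`). Each of `p` and
`q` divides just one of `u` and `v`. If both divide `u`, or one divides `u` and the other `v`, this is
the equation `A ^ 2 ± 64 p ^ a q ^ b = ± 1` or `A ^ 2 ± 64 q ^ b = ± p ^ a`, possibly after a swap. If
both divide `v`, then `u = ± 1`: for `u = -1` this is `A ^ 2 + 64 = p ^ a q ^ b`, and for `u = 1` the
coprime factors `A - 8` and `A + 8` of `v` differ by `16`, whence `|p ^ a - q ^ b| = 16` unless
`p ^ a + q ^ b = 16` or a factor is `± 1`; the products `p q` that occur in these last cases are the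
four excluded ones.
-/

/-! ### The integral equation `A ^ 2 - 64 u = v` -/

/-- An integer all of whose prime divisors are `p` or `q` is, up to sign, a product of powers of `p`
and `q`. -/
lemma Int.exists_eq_units_mul_pow_mul_pow {p q : ℕ} (hp : p.Prime) {x : ℤ}
    (hx : x ≠ 0) (h : ∀ r : ℕ, r.Prime → (r : ℤ) ∣ x → r = p ∨ r = q) :
    ∃ (e : ℤˣ) (a b : ℕ), x = e * ((p : ℤ) ^ a * (q : ℤ) ^ b) := by
  obtain ⟨a, n, hn, hxn⟩ :=
    Nat.exists_eq_pow_mul_and_not_dvd (Int.natAbs_ne_zero.mpr hx) p hp.ne_one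
  have hn0 : n ≠ 0 := by rintro rfl; simp at hn
  have hnq : n = q ^ n.primeFactorsList.length := by
    refine Nat.eq_prime_pow_of_unique_prime_dvd hn0 fun {d} hd hdn ↦ ?_
    refine (h d hd ?_).resolve_left ?_
    · rw [Int.natCast_dvd, hxn]
      exact hdn.mul_left _
    · rintro rfl
      exact hn hdn
  have hxa : (x.natAbs : ℤ) = (p : ℤ) ^ a * (q : ℤ) ^ n.primeFactorsList.length := by
    rw [hxn]; push_cast; congr 1; exact_mod_cast hnq
  rcases Int.natAbs_eq x with h' | h'
  · exact ⟨1, a, _, by rw [← hxa]; simpa using h'⟩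
  · exact ⟨-1, a, _, by rw [← hxa]; simpa using h'⟩

lemma Int.eq_zero_or_eq_zero_of_isCoprime_pow {p : ℕ} (hp : p.Prime) {x y : ℤ}
    (hxy : IsCoprime x y) {a b : ℕ} (hx : (p : ℤ) ^ a ∣ x) (hy : (p : ℤ) ^ b ∣ y) :
    a = 0 ∨ b = 0 := by
  by_contra! h
  exact (Nat.prime_iff_prime_int.mp hp).not_isUnit
    (hxy.isUnit_of_dvd' ((dvd_pow_self _ h.1).trans hx) ((dvd_pow_self _ h.2).trans hy))

lemma mul_mem_of_pow_add_pow_eq_sixteen {p q c d : ℕ} (hp : p.Prime) (hq : q.Prime)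
    (hp2 : Odd p) (hq2 : Odd q) (hpq : p ≠ q) (hc : c ≠ 0) (hd : d ≠ 0)
    (h : p ^ c + q ^ d = 16) : p * q ∈ ({15, 21, 39, 55} : Set ℕ) := by
  have key : ∀ {r e : ℕ}, r.Prime → Odd r → e ≠ 0 → r ^ e < 16 →
      (r = 3 ∧ r ^ e = 3) ∨ (r = 3 ∧ r ^ e = 9) ∨ (r = 5 ∧ r ^ e = 5) ∨ (r = 7 ∧ r ^ e = 7) ∨
        (r = 11 ∧ r ^ e = 11) ∨ (r = 13 ∧ r ^ e = 13) := by
    intro r e hr hr2 he h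
    have hr16 : r < 16 := (Nat.le_self_pow he r).trans_lt h
    have hr3 : 3 ≤ r := by
      have := hr.two_le
      obtain ⟨k, rfl⟩ := hr2
      omega
    have he3 : e < 3 := by
      by_contra! he3
      have := Nat.pow_le_pow_left hr3 3
      have := Nat.pow_le_pow_right hr.pos he3
      omega
    interval_cases r <;> first | (revert hr; norm_num; done) | (interval_cases e <;> simp_all)
  have hP := Nat.pow_pos (n := c) hp.pos
  have hQ := Nat.pow_pos (n := d) hq.pos
  simp only [Set.mem_insert_iff, Set.mem_singleton_iff]
  rcases key hp hp2 hc (by omega) with ⟨rfl, h1⟩ | ⟨rfl, h1⟩ | ⟨rfl, h1⟩ | ⟨rfl, h1⟩ | ⟨rfl, h1⟩ |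
    ⟨rfl, h1⟩ <;>
  rcases key hq hq2 hd (by omega) with ⟨rfl, h2⟩ | ⟨rfl, h2⟩ | ⟨rfl, h2⟩ | ⟨rfl, h2⟩ | ⟨rfl, h2⟩ |
    ⟨rfl, h2⟩ <;> omega

lemma mul_eq_fifteen_of_dvd {p q : ℕ} (hp : p.Prime) (hq : q.Prime) (hpq : p ≠ q) {x : ℤ}
    (hpx : (p : ℤ) ∣ x) (hqx : (q : ℤ) ∣ x) (hx : x = 15 ∨ x = -15 ∨ x = 17 ∨ x = -17) :
    p * q = 15 := by
  rw [Int.natCast_dvd] at hpx hqx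
  have h15 : ∀ {r : ℕ}, r.Prime → r ∣ 15 → r = 3 ∨ r = 5 := fun {r} hr h ↦ by
    rw [show 15 = 3 * 5 by norm_num, hr.dvd_mul, Nat.prime_dvd_prime_iff_eq hr (by norm_num),
      Nat.prime_dvd_prime_iff_eq hr (by norm_num)] at h
    exact h
  have h17 : ∀ {r : ℕ}, r.Prime → r ∣ 17 → r = 17 := fun {r} hr h ↦
    (Nat.prime_dvd_prime_iff_eq hr (by norm_num)).mp h
  have : x.natAbs = 15 ∨ x.natAbs = 17 := by omega
  rcases this with h | h <;> rw [h] at hpx hqx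
  · have h1 := h15 hp hpx
    have h2 := h15 hq hqx
    rcases h1 with rfl | rfl <;> rcases h2 with rfl | rfl <;> simp_all
  · exact absurd ((h17 hp hpx).trans (h17 hq hqx).symm) hpq

/-- The case `u = 1`: here `v = (A - 8) (A + 8)` with coprime factors, which differ by `16`. -/
lemma abs_pow_sub_pow_eq_sixteen {p q : ℕ} (hp : p.Prime) (hq : q.Prime)
    (hp2 : Odd p) (hq2 : Odd q) (hpq : p ≠ q) (hN : p * q ∉ ({15, 21, 39, 55} : Set ℕ))
    {A : ℤ} (hA : Odd A) (hA0 : A ^ 2 - 64 ≠ 0)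
    (h : ∀ r : ℕ, r.Prime → ((r : ℤ) ∣ A ^ 2 - 64 ↔ r = p ∨ r = q)) :
    ∃ a b : ℕ, 0 < a ∧ 0 < b ∧ |(p : ℤ) ^ a - (q : ℤ) ^ b| = 16 := by
  have hfac : A ^ 2 - 64 = (A - 8) * (A + 8) := by ring
  rw [hfac] at hA0 h
  obtain ⟨e₁, i, j, h₁⟩ := Int.exists_eq_units_mul_pow_mul_pow (q := q) hp (left_ne_zero_of_mul hA0)
    fun r hr hd ↦ (h r hr).mp (hd.mul_right _)
  obtain ⟨e₂, k, l, h₂⟩ := Int.exists_eq_units_mul_pow_mul_pow (q := q) hp (right_ne_zero_of_mul hA0)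
    fun r hr hd ↦ (h r hr).mp (hd.mul_left _)
  have hco : IsCoprime (A - 8) (A + 8) := by
    have : IsCoprime (A - 8) ((2 : ℤ) ^ 4) := by
      apply IsCoprime.pow_right
      obtain ⟨m, rfl⟩ := hA
      exact ⟨1, 4 - m, by ring⟩
    rw [show A + 8 = 2 ^ 4 + (A - 8) * 1 by ring]
    exact this.add_mul_left_right 1
  have hpi : (p : ℤ) ^ i ∣ A - 8 := h₁ ▸ (dvd_mul_right _ _).mul_left _
  have hqj : (q : ℤ) ^ j ∣ A - 8 := h₁ ▸ (dvd_mul_left _ _).mul_left _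
  have hpk : (p : ℤ) ^ k ∣ A + 8 := h₂ ▸ (dvd_mul_right _ _).mul_left _
  have hql : (q : ℤ) ^ l ∣ A + 8 := h₂ ▸ (dvd_mul_left _ _).mul_left _
  have hik := Int.eq_zero_or_eq_zero_of_isCoprime_pow hp hco hpi hpk
  have hjl := Int.eq_zero_or_eq_zero_of_isCoprime_pow hq hco hqj hql
  have hpd := (h p hp).mpr (.inl rfl)
  have hqd := (h q hq).mpr (.inr rfl)
  have h15 : p * q ≠ 15 := fun h ↦ hN (by simp [h])
  -- If one factor is a unit, then `A = ±7` or `A = ±9`, and `A ^ 2 - 64` is `-15` or `17`.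
  have hm : ¬ (A - 8 = 1 ∨ A - 8 = -1 ∨ A + 8 = 1 ∨ A + 8 = -1) := fun hu ↦ by
    refine h15 (mul_eq_fifteen_of_dvd hp hq hpq hpd hqd ?_)
    have : A = 9 ∨ A = 7 ∨ A = -7 ∨ A = -9 := by omega
    rcases this with rfl | rfl | rfl | rfl <;> norm_num
  have hm₁ : ¬ (i = 0 ∧ j = 0) := by
    rintro ⟨rfl, rfl⟩
    rcases Int.units_eq_one_or e₁ with rfl | rfl <;> simp at h₁ <;> omega
  have hm₂ : ¬ (k = 0 ∧ l = 0) := by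
    rintro ⟨rfl, rfl⟩
    rcases Int.units_eq_one_or e₂ with rfl | rfl <;> simp at h₂ <;> omega
  have hsum : ∀ {c d : ℕ}, c ≠ 0 → d ≠ 0 → (p : ℤ) ^ c + (q : ℤ) ^ d ≠ 16 := fun hc hd hs ↦
    hN (mul_mem_of_pow_add_pow_eq_sixteen hp hq hp2 hq2 hpq hc hd (by exact_mod_cast hs))
  have hpos : ∀ n, 0 < (p : ℤ) ^ n := fun n ↦ pow_pos (by exact_mod_cast hp.pos) n
  have hqos : ∀ n, 0 < (q : ℤ) ^ n := fun n ↦ pow_pos (by exact_mod_cast hq.pos) n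
  rcases Nat.eq_zero_or_pos i with rfl | hi
  · obtain rfl : l = 0 := by omega
    refine ⟨k, j, by omega, by omega, ?_⟩
    have := hsum (c := k) (d := j) (by omega) (by omega)
    have := hpos k
    have := hqos j
    rcases Int.units_eq_one_or e₁ with rfl | rfl <;>
      rcases Int.units_eq_one_or e₂ with rfl | rfl <;> simp at h₁ h₂ <;>
      rw [abs_eq (by norm_num)] <;> omega
  · obtain rfl : k = 0 := by omega
    obtain rfl : j = 0 := by omega
    refine ⟨i, l, by omega, by omega, ?_⟩
    have := hsum (c := i) (d := l) (by omega) (by omega)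
    have := hpos i
    have := hqos l
    rcases Int.units_eq_one_or e₁ with rfl | rfl <;>
      rcases Int.units_eq_one_or e₂ with rfl | rfl <;> simp at h₁ h₂ <;>
      rw [abs_eq (by norm_num)] <;> omega

/-- Since `u` and `v` are coprime, each of `p` and `q` divides exactly one of them; the four ways to
distribute the two primes give four of the seven equations. -/
lemma hasDiophantineSolution_of_sq_sub_eq {p q : ℕ} (hp : p.Prime) (hq : q.Prime)
    (hp2 : Odd p) (hq2 : Odd q) (hpq : p ≠ q) (hN : p * q ∉ ({15, 21, 39, 55} : Set ℕ))
    {A u v : ℤ} (hA : Odd A) (hAuv : A ^ 2 - 64 * u = v) (huv : IsCoprime u v)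
    (h : ∀ r : ℕ, r.Prime → ((r : ℤ) ∣ u * v ↔ r = p ∨ r = q)) :
    HasDiophantineSolution p q ∨ HasDiophantineSolution q p := by
  have h0 : u * v ≠ 0 := fun h0 ↦ by
    rcases (h 2 Nat.prime_two).mp (h0 ▸ dvd_zero _) with rfl | rfl
    · exact absurd hp2 (by decide)
    · exact absurd hq2 (by decide)
  obtain ⟨e₁, i, j, h₁⟩ := Int.exists_eq_units_mul_pow_mul_pow (q := q) hp (left_ne_zero_of_mul h0)
    fun r hr hd ↦ (h r hr).mp (hd.mul_right _)
  obtain ⟨e₂, k, l, h₂⟩ := Int.exists_eq_units_mul_pow_mul_pow (q := q) hp (right_ne_zero_of_mul h0)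
    fun r hr hd ↦ (h r hr).mp (hd.mul_left _)
  have hik := Int.eq_zero_or_eq_zero_of_isCoprime_pow hp huv
    (h₁ ▸ (dvd_mul_right _ _).mul_left _ : (p : ℤ) ^ i ∣ u)
    (h₂ ▸ (dvd_mul_right _ _).mul_left _ : (p : ℤ) ^ k ∣ v)
  have hjl := Int.eq_zero_or_eq_zero_of_isCoprime_pow hq huv
    (h₁ ▸ (dvd_mul_left _ _).mul_left _ : (q : ℤ) ^ j ∣ u)
    (h₂ ▸ (dvd_mul_left _ _).mul_left _ : (q : ℤ) ^ l ∣ v)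
  have hnd : ∀ {r s : ℕ}, r.Prime → s.Prime → r ≠ s → ∀ (e : ℤˣ) (n : ℕ),
      ¬ (r : ℤ) ∣ e * (s : ℤ) ^ n := fun {r s} hr hs hrs e n hd ↦ by
    rw [e.isUnit.dvd_mul_left] at hd
    exact hrs ((Nat.prime_dvd_prime_iff_eq hr hs).mp
      (by exact_mod_cast (Nat.prime_iff_prime_int.mp hr).dvd_of_dvd_pow hd))
  have hik' : ¬ (i = 0 ∧ k = 0) := by
    rintro ⟨rfl, rfl⟩
    have := (h p hp).mpr (.inl rfl)
    rw [(Nat.prime_iff_prime_int.mp hp).dvd_mul, h₁, h₂, pow_zero, one_mul, one_mul] at this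
    exact this.elim (hnd hp hq hpq _ _) (hnd hp hq hpq _ _)
  have hjl' : ¬ (j = 0 ∧ l = 0) := by
    rintro ⟨rfl, rfl⟩
    have := (h q hq).mpr (.inr rfl)
    rw [(Nat.prime_iff_prime_int.mp hq).dvd_mul, h₁, h₂, pow_zero, mul_one, mul_one] at this
    exact this.elim (hnd hq hp hpq.symm _ _) (hnd hq hp hpq.symm _ _)
  rcases Nat.eq_zero_or_pos i with rfl | hi <;> rcases Nat.eq_zero_or_pos j with rfl | hj
  · rcases Int.units_eq_one_or e₁ with rfl | rfl
    · obtain rfl : u = 1 := by simpa using h₁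
      rw [one_mul] at h h0
      subst hAuv
      obtain ⟨a, b, ha, hb, hab⟩ :=
        abs_pow_sub_pow_eq_sixteen hp hq hp2 hq2 hpq hN hA (by simpa using h0) (by simpa using h)
      exact .inl ⟨A, a, b, ha, hb, .inr (.inl hab)⟩
    · obtain rfl : u = -1 := by simpa using h₁
      refine .inl ⟨A, k, l, by omega, by omega, .inr (.inr (.inl ?_))⟩
      have hpos : 0 < (p : ℤ) ^ k * (q : ℤ) ^ l :=
        mul_pos (pow_pos (by exact_mod_cast hp.pos) _) (pow_pos (by exact_mod_cast hq.pos) _)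
      rcases Int.units_eq_one_or e₂ with rfl | rfl <;> simp at h₂ <;> nlinarith [sq_nonneg A]
  · obtain rfl : l = 0 := by omega
    refine .inl ⟨A, k, j, by omega, by omega, .inr (.inr (.inr (.inl ⟨-e₁, e₂, ?_⟩)))⟩
    simp only [pow_zero, one_mul, mul_one] at h₁ h₂
    push_cast
    linear_combination hAuv + 64 * h₁ + h₂
  · obtain rfl : k = 0 := by omega
    refine .inr ⟨A, l, i, by omega, by omega, .inr (.inr (.inr (.inl ⟨-e₁, e₂, ?_⟩)))⟩
    simp only [pow_zero, one_mul, mul_one] at h₁ h₂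
    push_cast
    linear_combination hAuv + 64 * h₁ + h₂
  · obtain rfl : k = 0 := by omega
    obtain rfl : l = 0 := by omega
    refine .inl ⟨A, i, j, by omega, by omega,
      .inr (.inr (.inr (.inr (.inr (.inr ⟨-e₁, e₂, ?_⟩)))))⟩
    simp only [pow_zero, mul_one] at h₁ h₂
    push_cast
    linear_combination hAuv + 64 * h₁ + h₂

/-- For odd `a`, take `u = b / 16`. For even `a`, the same choice is made on the `2`-isogenous curve
`Y ^ 2 = X ^ 3 - 2 a X ^ 2 + (a ^ 2 - 4 b) X`, rescaled by `2`: this amounts to `A = a / 2` and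
`v = b`. -/
lemma exists_sq_sub_eq {a b M : ℤ} (hab : IsCoprime a b)
    (h : b ^ 2 * (a ^ 2 - 4 * b) = 256 * M) :
    ∃ A u v : ℤ, Odd A ∧ A ^ 2 - 64 * u = v ∧ IsCoprime u v ∧
      ∀ r : ℤ, Prime r → (r ∣ u * v ↔ r ∣ M) := by
  rcases Int.even_or_odd a with ha | ha
  · obtain ⟨c, rfl⟩ := ha.two_dvd
    have hb : Odd b := by
      by_contra hb
      rw [Int.not_odd_iff_even] at hb
      exact absurd (hab.isUnit_of_dvd' (dvd_mul_right 2 c) hb.two_dvd) (by decide)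
    have hdvd : (2 : ℤ) ^ 6 ∣ c ^ 2 - b := by
      have h2 : IsCoprime ((2 : ℤ) ^ 6) (b ^ 2) := by
        apply IsCoprime.pow
        obtain ⟨m, rfl⟩ := hb
        exact ⟨-m, 1, by ring⟩
      exact h2.dvd_of_dvd_mul_left ⟨M, by linarith⟩
    obtain ⟨w, hw⟩ := hdvd
    have hMw : b ^ 2 * w = M := by
      have : b ^ 2 * (2 * c) ^ 2 - b ^ 2 * 4 * b = 256 * M := by linarith
      have : 256 * (b ^ 2 * w) = 256 * M := by linear_combination this - 4 * b ^ 2 * hw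
      linarith
    refine ⟨c, w, b, ?_, by linarith, ?_, fun r hr ↦ ?_⟩
    · by_contra hc
      rw [Int.not_odd_iff_even] at hc
      have : Even (c ^ 2 - 2 ^ 6 * w) := (hc.pow_of_ne_zero two_ne_zero).sub
        ((show Even ((2 : ℤ) ^ 6) by decide).mul_right _)
      rw [← hw, sub_sub_cancel] at this
      exact (Int.not_even_iff_odd.mpr hb) this
    · have hcb : IsCoprime (c ^ 2) b := (hab.of_mul_left_right).pow_left
      have : IsCoprime (2 ^ 6 * w) b := by
        rw [← hw]
        simpa [sub_eq_add_neg] using hcb.add_mul_left_left (-1)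
      exact this.of_mul_left_right
    · rw [← hMw, hr.dvd_mul, hr.dvd_mul, hr.dvd_pow_iff_dvd two_ne_zero, or_comm]
  · have hodd : Odd (a ^ 2 - 4 * b) :=
      (ha.pow).sub_even ((show Even (4 : ℤ) by decide).mul_right _)
    have hdvd : (2 : ℤ) ^ 4 ∣ b := by
      have h2 : IsCoprime (((2 : ℤ) ^ 4) ^ 2) (a ^ 2 - 4 * b) := by
        rw [← pow_mul]
        apply IsCoprime.pow_left
        obtain ⟨m, hm⟩ := hodd
        exact ⟨-m, 1, by rw [hm]; ring⟩
      exact (Int.pow_dvd_pow_iff two_ne_zero).mp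
        (h2.dvd_of_dvd_mul_right ⟨M, by linarith⟩)
    obtain ⟨u, rfl⟩ := hdvd
    have hMu : u ^ 2 * (a ^ 2 - 64 * u) = M := by linarith
    refine ⟨a, u, _, ha, rfl, ?_, fun r hr ↦ ?_⟩
    · have : IsCoprime u (a ^ 2) := (hab.of_mul_right_right).symm.pow_right
      simpa [sub_eq_add_neg, mul_comm] using this.add_mul_left_right (-64)
    · rw [← hMu, hr.dvd_mul, hr.dvd_mul, hr.dvd_pow_iff_dvd two_ne_zero]

/-! ### Points of order two and local reduction -/

namespace WeierstrassCurve

section TwoTorsion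

variable {R : Type*} [CommRing R] (W : WeierstrassCurve R)

/-- `X` is a root of the cubic that cuts out the points of order two, in the coordinate `X = 4 x`:
with `Y = 4 (2 y + a₁ x + a₃)` the equation of `W` becomes
`Y ^ 2 = X ^ 3 + b₂ X ^ 2 + 8 b₄ X + 16 b₆`. The factor `4` makes the cubic monic, so that over a
normal domain its roots are integral. -/
def IsTwoTorsionRoot (X : R) : Prop :=
  X ^ 3 + W.b₂ * X ^ 2 + 8 * W.b₄ * X + 16 * W.b₆ = 0

/-- The coefficient `A` of the equation `Y ^ 2 = X ^ 3 + A X ^ 2 + B X` obtained by moving the point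
of order two with coordinate `X` to the origin. -/
def twoTorsionA (X : R) : R :=
  3 * X + W.b₂

/-- The coefficient `B` of the equation `Y ^ 2 = X ^ 3 + A X ^ 2 + B X` obtained by moving the point
of order two with coordinate `X` to the origin. -/
def twoTorsionB (X : R) : R :=
  3 * X ^ 2 + 2 * W.b₂ * X + 8 * W.b₄

variable {W}

lemma twoTorsion_sq_mul_eq {X : R} (hX : W.IsTwoTorsionRoot X) :
    W.twoTorsionB X ^ 2 * (W.twoTorsionA X ^ 2 - 4 * W.twoTorsionB X) = 256 * W.Δ := by
  have h8 := W.b_relation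
  unfold IsTwoTorsionRoot at hX
  simp only [twoTorsionA, twoTorsionB, Δ]
  linear_combination (-(27 * X ^ 3) - 27 * W.b₂ * X ^ 2 - 216 * W.b₄ * X + 4 * W.b₂ ^ 3
    - 144 * W.b₂ * W.b₄ + 432 * W.b₆) * hX + (64 * W.b₂ ^ 2) * h8

lemma twoTorsion_c₄ (X : R) : W.twoTorsionA X ^ 2 - 3 * W.twoTorsionB X = W.c₄ := by
  simp only [twoTorsionA, twoTorsionB, c₄]
  ring

lemma twoTorsionA_map {S : Type*} [CommRing S] (f : R →+* S) (X : R) :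
    (W.map f).twoTorsionA (f X) = f (W.twoTorsionA X) := by
  simp [twoTorsionA, map_ofNat f]

lemma twoTorsionB_map {S : Type*} [CommRing S] (f : R →+* S) (X : R) :
    (W.map f).twoTorsionB (f X) = f (W.twoTorsionB X) := by
  simp [twoTorsionB, map_ofNat f]

lemma IsTwoTorsionRoot.map {S : Type*} [CommRing S] (f : R →+* S) {X : R}
    (hX : W.IsTwoTorsionRoot X) : (W.map f).IsTwoTorsionRoot (f X) := by
  simpa [IsTwoTorsionRoot, map_ofNat f] using congrArg f hX

lemma IsTwoTorsionRoot.of_map {S : Type*} [CommRing S] {f : R →+* S} (hf : Function.Injective f)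
    {X : R} (hX : (W.map f).IsTwoTorsionRoot (f X)) : W.IsTwoTorsionRoot X := by
  apply hf
  simpa [IsTwoTorsionRoot, map_ofNat f] using hX

lemma IsTwoTorsionRoot.variableChange {X : R} (hX : W.IsTwoTorsionRoot X)
    (C : VariableChange R) : (C • W).IsTwoTorsionRoot (C.u⁻¹ ^ 2 * (X - 4 * C.r)) := by
  simp only [IsTwoTorsionRoot, variableChange_b₂, variableChange_b₄, variableChange_b₆] at hX ⊢
  linear_combination (C.u⁻¹ ^ 6 : R) * hX

lemma twoTorsionA_variableChange (C : VariableChange R) (X : R) :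
    (C • W).twoTorsionA (C.u⁻¹ ^ 2 * (X - 4 * C.r)) = C.u⁻¹ ^ 2 * W.twoTorsionA X := by
  simp only [twoTorsionA, variableChange_b₂]
  ring

lemma twoTorsionB_variableChange (C : VariableChange R) (X : R) :
    (C • W).twoTorsionB (C.u⁻¹ ^ 2 * (X - 4 * C.r)) = C.u⁻¹ ^ 4 * W.twoTorsionB X := by
  simp only [twoTorsionB, variableChange_b₂, variableChange_b₄]
  ring

lemma exists_isTwoTorsionRoot {F : Type*} [Field F] [DecidableEq F] {W : WeierstrassCurve F}
    {P : W.toAffine.Point} (hP : addOrderOf P = 2) : ∃ X, W.IsTwoTorsionRoot X := by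
  rcases P with _ | ⟨x, y, h⟩
  · exact absurd (hP.symm.trans addOrderOf_zero) (by norm_num)
  · have h2 : Affine.Point.some x y h = -Affine.Point.some x y h := by
      rw [eq_neg_iff_add_eq_zero, ← two_nsmul, ← hP, addOrderOf_nsmul_eq_zero]
    rw [Affine.Point.neg_some, Affine.Point.some.injEq] at h2
    have hy : y = -y - W.a₁ * x - W.a₃ := h2.2
    have heq := (Affine.equation_iff ..).mp h.1
    refine ⟨4 * x, ?_⟩
    simp only [IsTwoTorsionRoot, b₂, b₄, b₆]
    simp only [toAffine] at heq
    linear_combination (-64 : F) * heq + 16 * (2 * y + W.a₁ * x + W.a₃) * hy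

lemma IsTwoTorsionRoot.exists_algebraMap_eq {K : Type*} [Field K] [Algebra R K]
    [IsFractionRing R K] [IsDomain R] [IsIntegrallyClosed R] {X : K}
    (hX : (W.map (algebraMap R K)).IsTwoTorsionRoot X) : ∃ Y : R, algebraMap R K Y = X := by
  rw [← IsIntegrallyClosed.isIntegral_iff]
  refine ⟨.X ^ 3 + .C W.b₂ * .X ^ 2 + .C (8 * W.b₄) * .X + .C (16 * W.b₆), by monicity!, ?_⟩
  simpa [IsTwoTorsionRoot, map_ofNat (algebraMap R K)] using hX

end TwoTorsion

/-- If `W` is smooth or has a node modulo `p`, then `A` and `B` do not both vanish there. The only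
case not settled by `A ^ 2 - 3 B = c₄` and `B ^ 2 (A ^ 2 - 4 B) = 256 Δ` is good supersingular
reduction at `2`, where the cubic has no root over `ℤ_[2]`: the Newton polygon has slope `4 / 3`. -/
lemma norm_twoTorsion_eq_one {p : ℕ} [Fact p.Prime] {W : WeierstrassCurve ℤ_[p]} {X : ℤ_[p]}
    (hX : W.IsTwoTorsionRoot X) (h : ‖W.Δ‖ = 1 ∨ ‖W.c₄‖ = 1) :
    ‖W.twoTorsionA X‖ = 1 ∨ ‖W.twoTorsionB X‖ = 1 := by
  have hdvd : ∀ z : ℤ_[p], ‖z‖ = 1 ↔ ¬ (p : ℤ_[p]) ∣ z := fun z ↦ by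
    rw [← PadicInt.norm_lt_one_iff_dvd, not_lt]
    exact ⟨fun h ↦ h.ge, fun h ↦ (PadicInt.norm_le_one z).antisymm h⟩
  have hpr : Prime (p : ℤ_[p]) := PadicInt.prime_p
  simp only [hdvd] at h ⊢
  by_contra! hAB
  obtain ⟨hA, hB⟩ := hAB
  have hc₄ : (p : ℤ_[p]) ∣ W.c₄ := by
    rw [← twoTorsion_c₄ X]
    exact dvd_sub (dvd_pow hA two_ne_zero) (hB.mul_left _)
  have hΔ := h.resolve_right (not_not.mpr hc₄)
  have h256 : (p : ℤ_[p]) ∣ 256 := by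
    refine (hpr.dvd_or_dvd ?_).resolve_right hΔ
    rw [← twoTorsion_sq_mul_eq hX]
    exact (dvd_pow hB two_ne_zero).mul_right _
  have hp2 : p = 2 := by
    have h256' : (p : ℤ_[p]) ∣ ((256 : ℤ) : ℤ_[p]) := by exact_mod_cast h256
    rw [← PadicInt.norm_lt_one_iff_dvd, PadicInt.norm_int_lt_one_iff_dvd] at h256'
    have : p ∣ 2 ^ 8 := by exact_mod_cast h256'
    exact (Nat.prime_dvd_prime_iff_eq (Fact.out : p.Prime) Nat.prime_two).mp
      ((Fact.out : p.Prime).dvd_of_dvd_pow this)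
  subst hp2
  push_cast at *
  -- A root would be divisible by `4`, whence `b₆` and with it `Δ` would be even.
  have h20 : (2 : ℤ_[2]) ≠ 0 := two_ne_zero
  have ha₁ : (2 : ℤ_[2]) ∣ W.a₁ := by
    have hc : W.c₄ = W.a₁ ^ 4 + 2 * (4 * W.a₁ ^ 2 * W.a₂ + 8 * W.a₂ ^ 2 - 12 * W.b₄) := by
      simp only [c₄, b₂]
      ring
    rw [hc, dvd_add_left (dvd_mul_right _ _)] at hc₄
    exact hpr.dvd_of_dvd_pow hc₄
  obtain ⟨s, hs⟩ := ha₁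
  have hb₂ : W.b₂ = 4 * (s ^ 2 + W.a₂) := by
    simp only [b₂, hs]
    ring
  have hb₄ : W.b₄ = 2 * (W.a₄ + s * W.a₃) := by
    simp only [b₄, hs]
    ring
  unfold IsTwoTorsionRoot at hX
  obtain ⟨Y, rfl⟩ : (2 : ℤ_[2]) ∣ X := by
    refine hpr.dvd_of_dvd_pow (n := 3)
      ⟨-(2 * (s ^ 2 + W.a₂) * X ^ 2 + 8 * (W.a₄ + s * W.a₃) * X + 8 * W.b₆), ?_⟩
    rw [hb₂, hb₄] at hX
    linear_combination hX
  have hY : Y ^ 3 = 2 * -((s ^ 2 + W.a₂) * Y ^ 2 + W.b₄ * Y + W.b₆) := by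
    refine mul_left_cancel₀ (pow_ne_zero 3 h20) ?_
    rw [hb₂] at hX
    linear_combination hX
  obtain ⟨Z, rfl⟩ := hpr.dvd_of_dvd_pow (Dvd.intro _ hY.symm)
  have hb₆ : W.b₆ = 2 * -(2 * Z ^ 3 + 2 * (s ^ 2 + W.a₂) * Z ^ 2 + W.b₄ * Z) := by
    refine mul_left_cancel₀ h20 ?_
    linear_combination hY
  refine hΔ ?_
  rw [Δ, hb₂, hb₄, hb₆]
  refine ⟨-(8 * (s ^ 2 + W.a₂) ^ 2 * W.b₈) - 32 * (W.a₄ + s * W.a₃) ^ 3 -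
    54 * (2 * Z ^ 3 + 2 * (s ^ 2 + W.a₂) * Z ^ 2 + W.b₄ * Z) ^ 2 -
    72 * (s ^ 2 + W.a₂) * (W.a₄ + s * W.a₃) *
      (2 * Z ^ 3 + 2 * (s ^ 2 + W.a₂) * Z ^ 2 + W.b₄ * Z), ?_⟩
  rw [hb₄]
  ring

lemma valuation_maximalIdeal_eq_one_iff {p : ℕ} [Fact p.Prime] (z : ℤ_[p]) :
    (IsDiscreteValuationRing.maximalIdeal ℤ_[p]).valuation ℚ_[p] (algebraMap ℤ_[p] ℚ_[p] z) = 1 ↔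
      ‖z‖ = 1 := by
  rw [IsDedekindDomain.HeightOneSpectrum.valuation_eq_one_iff_notMem]
  change z ∉ IsLocalRing.maximalIdeal ℤ_[p] ↔ _
  rw [IsLocalRing.mem_maximalIdeal, PadicInt.mem_nonunits, not_lt]
  exact ⟨fun h ↦ (PadicInt.norm_le_one z).antisymm h, fun h ↦ h.ge⟩

/-- At a prime `p` where the conductor exponent is at most `1`, a suitable scaling by
`c ^ 2` and `c ^ 4` turns `A` and `B` into `p`-adic integers that are not both divisible by `p`, and
the discriminant, scaled by `c ^ 12`, is a unit exactly if the exponent is `0`. -/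
lemma exists_local_scaling {W : WeierstrassCurve ℚ} {X : ℚ} (hX : W.IsTwoTorsionRoot X)
    (p : ℕ) [Fact p.Prime] (hp : W.conductorExponent p ≤ 1) :
    ∃ (c : ℚ_[p]) (α β δ : ℤ_[p]), (α : ℚ_[p]) = c ^ 2 * (W.twoTorsionA X : ℚ) ∧
      (β : ℚ_[p]) = c ^ 4 * (W.twoTorsionB X : ℚ) ∧ (δ : ℚ_[p]) = c ^ 12 * (W.Δ : ℚ) ∧
      (‖α‖ = 1 ∨ ‖β‖ = 1) ∧ (‖δ‖ = 1 ↔ W.conductorExponent p = 0) := by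
  classical
  set Wp : WeierstrassCurve ℚ_[p] := W.baseChange ℚ_[p] with hWp
  obtain ⟨C, hC⟩ : ∃ C : VariableChange ℚ_[p], Wp.minimal ℤ_[p] = C • Wp := ⟨_, rfl⟩
  set I := (Wp.minimal ℤ_[p]).integralModel ℤ_[p]
  have hI : C • Wp = I.map (algebraMap ℤ_[p] ℚ_[p]) :=
    hC.symm.trans (baseChange_integralModel_eq ℤ_[p] _).symm
  have hXp : Wp.IsTwoTorsionRoot (algebraMap ℚ ℚ_[p] X) := hX.map _
  have hXC := hXp.variableChange C
  obtain ⟨Y, hY⟩ := (hI ▸ hXC).exists_algebraMap_eq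
  have hIY : I.IsTwoTorsionRoot Y := by
    rw [hI, ← hY] at hXC
    exact hXC.of_map (IsFractionRing.injective ℤ_[p] ℚ_[p])
  have hgood : (Wp.minimal ℤ_[p]).HasGoodReduction ℤ_[p] ↔ ‖I.Δ‖ = 1 := by
    rw [hasGoodReduction_iff, ← valuation_maximalIdeal_eq_one_iff, integralModel_Δ_eq]
    exact and_iff_right inferInstance
  have hmult : (Wp.minimal ℤ_[p]).HasMultiplicativeReduction ℤ_[p] → ‖I.c₄‖ = 1 := fun h ↦ by
    rw [← valuation_maximalIdeal_eq_one_iff, integralModel_c₄_eq]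
    exact h.multiplicativeReduction
  refine ⟨(C.u⁻¹ : ℚ_[p]ˣ), I.twoTorsionA Y, I.twoTorsionB Y, I.Δ, ?_, ?_, ?_,
    norm_twoTorsion_eq_one hIY ?_, ?_⟩
  · rw [← PadicInt.algebraMap_apply, ← twoTorsionA_map, ← hI, hY, twoTorsionA_variableChange]
    rw [hWp, baseChange, twoTorsionA_map, eq_ratCast]
  · rw [← PadicInt.algebraMap_apply, ← twoTorsionB_map, ← hI, hY, twoTorsionB_variableChange]
    rw [hWp, baseChange, twoTorsionB_map, eq_ratCast]
  · rw [← PadicInt.algebraMap_apply, ← map_Δ, ← hI, variableChange_Δ, hWp, baseChange, map_Δ,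
      eq_ratCast]
  · rw [← hgood]
    rw [conductorExponent] at hp
    split_ifs at hp with h₁ h₂
    · exact .inl h₁
    · exact .inr (hmult h₂)
    · omega
  · rw [← hgood, conductorExponent]
    split_ifs with h₁ h₂ <;> simp [hWp.symm ▸ h₁]

/-- A conductor other than `1` is a product over finitely many primes, so that its factorization
gives the conductor exponents. -/
lemma factorization_conductor {W : WeierstrassCurve ℚ} (hW : W.conductor ≠ 1)
    (p : ℕ) [hp : Fact p.Prime] : W.conductor.factorization p = W.conductorExponent p := by
  let f : Nat.Primes → ℕ := fun q ↦
    haveI : Fact (q : ℕ).Prime := ⟨q.2⟩; (q : ℕ) ^ W.conductorExponent q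
  have hf : W.conductor = ∏ᶠ q, f q := rfl
  have hfin : (Function.mulSupport f).Finite := by
    by_contra h
    exact hW (hf.trans (finprod_of_infinite_mulSupport h))
  let s : Finset Nat.Primes := insert ⟨p, hp.out⟩ hfin.toFinset
  rw [hf, finprod_eq_prod_of_mulSupport_subset (s := s) f (fun x hx ↦
      Finset.mem_coe.mpr (Finset.mem_insert_of_mem (hfin.mem_toFinset.mpr hx))),
    Nat.factorization_prod fun q _ ↦ pow_ne_zero _ q.2.ne_zero, Finsupp.finsetSum_apply,
    Finset.sum_eq_single ⟨p, hp.out⟩]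
  · simp [hp.out.factorization_self]
  · intro q _ hq
    have : (q : ℕ) ≠ p := fun h ↦ hq (Subtype.ext h)
    simp [q.2.factorization, this]
  · intro h
    exact absurd (Finset.mem_insert_self _ _) h

end WeierstrassCurve

/-! ### A global integral model -/

/-- Among all integral pairs `(k ^ 2 A, k ^ 4 B)`, one with the smallest `B` cannot be scaled
down at any prime. -/
lemma exists_minimal_scaling (A : ℚ) {B : ℚ} (hB : B ≠ 0) :
    ∃ (k : ℚ) (a b : ℤ), k ≠ 0 ∧ (a : ℚ) = k ^ 2 * A ∧ (b : ℚ) = k ^ 4 * B ∧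
      ∀ r : ℕ, r.Prime → ¬ ((r : ℤ) ^ 2 ∣ a ∧ (r : ℤ) ^ 4 ∣ b) := by
  classical
  have hex : ∃ (n : ℕ) (k : ℚ) (a b : ℤ), k ≠ 0 ∧ (a : ℚ) = k ^ 2 * A ∧ (b : ℚ) = k ^ 4 * B ∧
      b.natAbs = n := by
    have hA' : (A.den : ℚ) ≠ 0 := by exact_mod_cast A.den_ne_zero
    have hB' : (B.den : ℚ) ≠ 0 := by exact_mod_cast B.den_ne_zero
    refine ⟨_, A.den * B.den, A.num * A.den * B.den ^ 2, B.num * A.den ^ 4 * B.den ^ 3,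
      mul_ne_zero hA' hB', ?_, ?_, rfl⟩
    · push_cast
      linear_combination (-A.den * B.den ^ 2 : ℚ) * A.mul_den_eq_num
    · push_cast
      linear_combination (-A.den ^ 4 * B.den ^ 3 : ℚ) * B.mul_den_eq_num
  obtain ⟨k, a, b, hk, ha, hb, hn⟩ := Nat.find_spec hex
  refine ⟨k, a, b, hk, ha, hb, ?_⟩
  rintro r hr ⟨⟨a', rfl⟩, ⟨b', rfl⟩⟩
  have hr0 : (r : ℚ) ≠ 0 := by exact_mod_cast hr.ne_zero
  push_cast at ha hb
  refine Nat.find_min hex (m := b'.natAbs) ?_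
    ⟨k / r, a', b', div_ne_zero hk hr0, ?_, ?_, rfl⟩
  · have hb0 : b'.natAbs ≠ 0 := by
      rw [Int.natAbs_ne_zero]
      rintro rfl
      refine mul_ne_zero (pow_ne_zero 4 hk) hB ?_
      simpa using hb.symm
    rw [← hn, Int.natAbs_mul, Int.natAbs_pow, Int.natAbs_natCast]
    exact lt_mul_of_one_lt_left (Nat.pos_of_ne_zero hb0) (Nat.one_lt_pow (by norm_num) hr.one_lt)
  · field_simp
    linear_combination ha
  · field_simp
    linear_combination hb

/-- If a pair that cannot be scaled down at `p` becomes integral and not divisible by `p` after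
scaling by `c`, then `c` is a unit at `p`. -/
lemma norm_eq_one_of_scaling {p : ℕ} [Fact p.Prime] {a b : ℤ} {c : ℚ_[p]} {α β : ℤ_[p]}
    (hα : (α : ℚ_[p]) = c ^ 2 * a) (hβ : (β : ℚ_[p]) = c ^ 4 * b)
    (h : ‖α‖ = 1 ∨ ‖β‖ = 1) (hmin : ¬ ((p : ℤ) ^ 2 ∣ a ∧ (p : ℤ) ^ 4 ∣ b)) : ‖c‖ = 1 := by
  have hα' : ‖α‖ = ‖c‖ ^ 2 * ‖(a : ℚ_[p])‖ := by rw [PadicInt.norm_def, hα, norm_mul, norm_pow]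
  have hβ' : ‖β‖ = ‖c‖ ^ 4 * ‖(b : ℚ_[p])‖ := by rw [PadicInt.norm_def, hβ, norm_mul, norm_pow]
  have ha1 := Padic.norm_int_le_one (p := p) a
  have hb1 := Padic.norm_int_le_one (p := p) b
  have hc0 := norm_nonneg c
  rcases lt_trichotomy ‖c‖ 1 with hc | hc | hc
  · have h2 : ‖c‖ ^ 2 < 1 := pow_lt_one₀ hc0 hc two_ne_zero
    have h4 : ‖c‖ ^ 4 < 1 := pow_lt_one₀ hc0 hc four_ne_zero
    rcases h with h | h
    · exact absurd h (hα' ▸ (mul_lt_one_of_nonneg_of_lt_one_left (by positivity) h2 ha1).ne)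
    · exact absurd h (hβ' ▸ (mul_lt_one_of_nonneg_of_lt_one_left (by positivity) h4 hb1).ne)
  · exact hc
  · have hp0 : (0 : ℝ) < p := by exact_mod_cast (Fact.out : p.Prime).pos
    have hcp : (p : ℝ) ≤ ‖c‖ := by
      have hcne : c ≠ 0 := by
        rintro rfl
        simp at hc
        linarith
      rw [Padic.norm_eq_zpow_neg_valuation hcne] at hc ⊢
      have hp1 : (1 : ℝ) < p := by exact_mod_cast (Fact.out : p.Prime).one_lt
      have : 0 < -c.valuation := (one_lt_zpow_iff_right₀ hp1).mp hc
      calc (p : ℝ) = (p : ℝ) ^ (1 : ℤ) := (zpow_one _).symm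
        _ ≤ _ := zpow_le_zpow_right₀ hp1.le (by omega)
    have key : ∀ {z : ℤ} {n : ℕ}, ‖c‖ ^ n * ‖(z : ℚ_[p])‖ ≤ 1 → (p : ℤ) ^ n ∣ z := by
      intro z n hz
      have := (Padic.norm_int_le_pow_iff_dvd (p := p) z n).mp ?_
      · exact_mod_cast this
      · rw [zpow_neg, zpow_natCast, ← one_div, le_div_iff₀ (pow_pos hp0 n), mul_comm]
        exact (mul_le_mul_of_nonneg_right (pow_le_pow_left₀ hp0.le hcp n) (norm_nonneg _)).trans hz
    exact absurd ⟨key (hα' ▸ PadicInt.norm_le_one α), key (hβ' ▸ PadicInt.norm_le_one β)⟩ hmin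

namespace WeierstrassCurve

/-- A semistable elliptic curve over `ℚ` with a point of order two comes from a single pair of
coprime integers `a` and `b`, and `b ^ 2 (a ^ 2 - 4 b) / 2 ^ 8` is divisible exactly by the primes
of bad reduction. The class number of `ℚ` being one is used in the form of
`exists_minimal_scaling`. -/
lemma exists_coprime_model {W : WeierstrassCurve ℚ} [W.IsElliptic] {X : ℚ}
    (hX : W.IsTwoTorsionRoot X)
    (hW : ∀ (p : ℕ) [Fact p.Prime], W.conductorExponent p ≤ 1) :
    ∃ a b M : ℤ, IsCoprime a b ∧ b ^ 2 * (a ^ 2 - 4 * b) = 256 * M ∧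
      ∀ (p : ℕ) [Fact p.Prime], (p : ℤ) ∣ M ↔ W.conductorExponent p ≠ 0 := by
  have hΔ : W.Δ ≠ 0 := W.isUnit_Δ.ne_zero
  have hrel := twoTorsion_sq_mul_eq hX
  have hB : W.twoTorsionB X ≠ 0 := fun h ↦ hΔ (by simpa [h] using hrel)
  obtain ⟨k, a, b, hk, ha, hb, hmin⟩ := exists_minimal_scaling (W.twoTorsionA X) hB
  have hrel' : ((b ^ 2 * (a ^ 2 - 4 * b) : ℤ) : ℚ) = 256 * (k ^ 12 * W.Δ) := by
    push_cast
    rw [ha, hb]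
    linear_combination k ^ 12 * hrel
  have hloc : ∀ (p : ℕ) [Fact p.Prime], (‖(a : ℚ_[p])‖ = 1 ∨ ‖(b : ℚ_[p])‖ = 1) ∧
      ‖((k ^ 12 * W.Δ : ℚ) : ℚ_[p])‖ ≤ 1 ∧
      (‖((k ^ 12 * W.Δ : ℚ) : ℚ_[p])‖ = 1 ↔ W.conductorExponent p = 0) := by
    intro p hp
    obtain ⟨c, α, β, δ, hα, hβ, hδ, h1, hgood⟩ := exists_local_scaling hX p (hW p)
    have hkp : (k : ℚ_[p]) ≠ 0 := by exact_mod_cast hk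
    have ha' : (a : ℚ_[p]) = k ^ 2 * (W.twoTorsionA X : ℚ) := by
      exact_mod_cast congrArg (Rat.cast : ℚ → ℚ_[p]) ha
    have hb' : (b : ℚ_[p]) = k ^ 4 * (W.twoTorsionB X : ℚ) := by
      exact_mod_cast congrArg (Rat.cast : ℚ → ℚ_[p]) hb
    have hα' : (α : ℚ_[p]) = (c / k) ^ 2 * a := by
      rw [hα, ha']
      field_simp
    have hβ' : (β : ℚ_[p]) = (c / k) ^ 4 * b := by
      rw [hβ, hb']
      field_simp
    have hδ' : (δ : ℚ_[p]) = (c / k) ^ 12 * ((k ^ 12 * W.Δ : ℚ) : ℚ_[p]) := by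
      rw [hδ]
      push_cast
      field_simp
    have hck := norm_eq_one_of_scaling hα' hβ' h1 (hmin p hp.out)
    have hnα := congrArg norm hα'
    have hnβ := congrArg norm hβ'
    have hnδ := congrArg norm hδ'
    rw [norm_mul, norm_pow, hck, one_pow, one_mul, ← PadicInt.norm_def] at hnα hnβ hnδ
    rw [← hnα, ← hnβ, ← hnδ]
    exact ⟨h1, PadicInt.norm_le_one δ, hgood⟩
  -- As `256 Δ` is an integer after scaling, integrality of the scaled `Δ` is only in question at `2`.
  have h256 : (256 : ℤ) ∣ b ^ 2 * (a ^ 2 - 4 * b) := by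
    have := (Padic.norm_int_le_pow_iff_dvd (p := 2) (b ^ 2 * (a ^ 2 - 4 * b)) 8).mp ?_
    · simpa using this
    · have hcast : ((b ^ 2 * (a ^ 2 - 4 * b) : ℤ) : ℚ_[2]) =
          (2 : ℕ) ^ 8 * ((k ^ 12 * W.Δ : ℚ) : ℚ_[2]) := by
        rw [← Rat.cast_intCast, hrel']
        push_cast
        norm_num
      rw [hcast, norm_mul, Padic.norm_p_pow]
      exact mul_le_of_le_one_right (by positivity) (hloc 2).2.1
  obtain ⟨M, hM⟩ := h256
  have hMΔ : (M : ℚ) = k ^ 12 * W.Δ := by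
    have : (256 : ℚ) * M = 256 * (k ^ 12 * W.Δ) := by
      rw [← hrel', hM]
      push_cast
      rfl
    linarith
  refine ⟨a, b, M, ?_, hM, fun p hp ↦ ?_⟩
  · rw [Int.isCoprime_iff_gcd_eq_one]
    by_contra h
    obtain ⟨p, hp, hpd⟩ := Nat.exists_prime_and_dvd h
    have : Fact p.Prime := ⟨hp⟩
    have hpa : (p : ℤ) ∣ a := (Int.natCast_dvd_natCast.mpr hpd).trans (Int.gcd_dvd_left ..)
    have hpb : (p : ℤ) ∣ b := (Int.natCast_dvd_natCast.mpr hpd).trans (Int.gcd_dvd_right ..)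
    rw [← Padic.norm_intCast_lt_one_iff] at hpa hpb
    exact (hloc p).1.elim hpa.ne hpb.ne
  · obtain ⟨-, hle, hiff⟩ := hloc p
    rw [← hMΔ, Rat.cast_intCast] at hle hiff
    rw [← Padic.norm_intCast_lt_one_iff, ← not_iff_not, not_not, ← hiff, not_lt]
    exact ⟨fun h ↦ hle.antisymm h, fun h ↦ h.ge⟩

end WeierstrassCurve

/-! ### From the conductor to the equations -/

theorem theorem3p2 (p q : ℕ) (hp : p.Prime) (hq : q.Prime) (hp2 : Odd p) (hq2 : Odd q)
    (hpq : p ≠ q)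
    (hE : ∃ (W : WeierstrassCurve ℚ) (_ : W.IsElliptic),
      W.conductor = p * q ∧ ∃ P : W.toAffine.Point, addOrderOf P = 2)
    (hN : p * q ∉ ({15, 21, 39, 55} : Set ℕ)) :
    HasDiophantineSolution p q ∨ HasDiophantineSolution q p := by
  obtain ⟨W, _, hcond, P, hP⟩ := hE
  obtain ⟨X, hX⟩ := WeierstrassCurve.exists_isTwoTorsionRoot hP
  have hexp : ∀ (r : ℕ) [Fact r.Prime],
      W.conductorExponent r = if r = p ∨ r = q then 1 else 0 := by
    intro r _
    rw [← WeierstrassCurve.factorization_conductor, hcond,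
      Nat.factorization_mul hp.ne_zero hq.ne_zero, Finsupp.add_apply, hp.factorization,
      hq.factorization, Finsupp.single_apply, Finsupp.single_apply]
    · by_cases h₁ : p = r
      · have h₂ : q ≠ r := fun h ↦ hpq (h₁.trans h.symm)
        simp [h₁, h₂]
      · simp [h₁, Ne.symm h₁, eq_comm]
    · rw [hcond]
      exact fun h ↦ hp.ne_one (Nat.eq_one_of_mul_eq_one_right h)
  obtain ⟨a, b, M, hab, hM, hdvd⟩ := WeierstrassCurve.exists_coprime_model hX fun r _ ↦ by
    rw [hexp r]
    split_ifs <;> norm_num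
  obtain ⟨A, u, v, hA, hAuv, huv, huvM⟩ := exists_sq_sub_eq hab hM
  refine hasDiophantineSolution_of_sq_sub_eq hp hq hp2 hq2 hpq hN hA hAuv huv fun r hr ↦ ?_
  have : Fact r.Prime := ⟨hr⟩
  rw [huvM r (Nat.prime_iff_prime_int.mp hr), hdvd r, hexp r]
  split_ifs with h <;> simp [h]
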